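/- Let $n\ge 1$, identify $\mathbb C^n$ with $\mathbb R^{2n}$, and let $|\cdot|$ be the Euclidean norm, $\lambda$ the Lebesgue measure and $B(r)$ the ball of radius $r$ centred at $0$. Let $E\subset\mathbb C^n$ be a Lebesgue measurable set of zero relative Lebesgue density, i.e. $$\lim_{r\to+\infty}\frac{\lambda(E\cap B(r))}{r^{2n}}=0 .$$ The order of a function $u\colon\mathbb C^n\to[-\infty,+\infty)$ is $$\operatorname{ord}[u]:=\limsup_{|z|\to\infty}\frac{\ln\bigl(1+u^+(z)\bigr)}{\ln|z|},\qquad u^+:=\max\{0,u\},$$ and the order of an entire function $f$ on $\mathbb C^n$ is $\operatorname{ord}[\ln|f|]$. Then: 1. every plurisubharmonic function $u\colon\mathbb C^n\to[-\infty,+\infty)$ (upper semicontinuous, with subharmonic restriction to every complex line, the function identically $-\infty$ being allowed) that has finite order, $\operatorname{ord}[u]<+\infty$, and is bounded above on $\mathbb C^n\setminus E$ is constant; 2. every entire function $f\colon\mathbb C^n\to\mathbb C$ of finite order for which $|f|$ is bounded above on $\mathbb C^n\setminus E$ is constant. -/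

import Mathlib

open MeasureTheory Filter Topology

/-- The mean `(1 / 2π) ∫₀^{2π} u (c + r e^{iθ}) dθ` of an extended-real function over the circle of
centre `c` and radius `r`, as the mean of the positive part minus the mean of the negative part.
If `u` is bounded above on the circle the first mean is finite, and the value is a real number
or `-∞`. -/
noncomputable def erealCircleMean (u : ℂ → EReal) (c : ℂ) (r : ℝ) : EReal :=
  (((ENNReal.ofReal (2 * Real.pi))⁻¹ *
      ∫⁻ θ in Set.Ioc 0 (2 * Real.pi), (u (circleMap c r θ)).toENNReal : ENNReal) : EReal) -
  (((ENNReal.ofReal (2 * Real.pi))⁻¹ *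
      ∫⁻ θ in Set.Ioc 0 (2 * Real.pi), (-u (circleMap c r θ)).toENNReal : ENNReal) : EReal)

/-- Subharmonic functions on the complex plane: upper semicontinuous, with values in `[-∞, +∞)`,
and satisfying the sub-mean value inequality on circles. The function identically `-∞` is
allowed. -/
structure IsSubharmonicOnPlane (u : ℂ → EReal) : Prop where
  upperSemicontinuous : UpperSemicontinuous u
  lt_top : ∀ z, u z < ⊤
  le_circleMean : ∀ (c : ℂ) (r : ℝ), 0 < r → u c ≤ erealCircleMean u c r

/-- Plurisubharmonic functions on `ℂⁿ`: upper semicontinuous, with subharmonic restriction to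
every complex line. -/
structure IsPlurisubharmonic {n : ℕ} (u : EuclideanSpace ℂ (Fin n) → EReal) : Prop where
  upperSemicontinuous : UpperSemicontinuous u
  subharmonic_line : ∀ a b : EuclideanSpace ℂ (Fin n), b ≠ 0 →
    IsSubharmonicOnPlane (fun ζ : ℂ => u (a + ζ • b))

/-- The order `limsup_{|z| → ∞} ln (1 + u⁺ z) / ln |z|` of an extended-real function. -/
noncomputable def growthOrder {n : ℕ} (u : EuclideanSpace ℂ (Fin n) → EReal) : EReal :=
  limsup (fun z => ENNReal.log (1 + (u z).toENNReal) / (Real.log ‖z‖ : EReal))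
    (Bornology.cobounded (EuclideanSpace ℂ (Fin n)))

/-- `ln |f|`, with value `-∞` at the zeros of `f`. -/
noncomputable def logAbs {n : ℕ} (f : EuclideanSpace ℂ (Fin n) → ℂ) :
    EuclideanSpace ℂ (Fin n) → EReal :=
  fun z => ENNReal.log ‖f z‖ₑ

/-- `E ⊆ ℂⁿ` is Lebesgue measurable and `lim_{r → +∞} λ (E ∩ B(r)) / r^{2n}` exists and equals `d`.
Here `volume` is Lebesgue measure on `ℂⁿ = ℝ²ⁿ` and `B(r)` is the Euclidean ball. -/
def HasRelativeLebesgueDensity {n : ℕ} (E : Set (EuclideanSpace ℂ (Fin n))) (d : ℝ) : Prop :=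
  NullMeasurableSet E volume ∧
  Tendsto (fun r : ℝ => volume.real (E ∩ Metric.ball 0 r) / r ^ (2 * n)) atTop (𝓝 d)

/-! Let `v` be `u⁺`, respectively `ln⁺ |f|`. It is at most its mean over every ball, and finite
order gives `v z ≤ C (1 + ‖z‖) ^ N`. If `‖a‖ ≤ r`, the ball `B(a, r)` lies in `B(2r)`, and for large
`r` the set `E` fills at most a fraction `δ = 2^{-(N+1)}` of it, so `sup_{B(r)} v ≤ K + δ
sup_{B(2r)} v`, where `K` bounds `v` off `E`. Each doubling of the radius costs a factor `2 ^ N` in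
the growth bound and gains `δ`; iterating gives `v ≤ 2K` everywhere
(`bounded_of_bounded_off_density_zero`). A plurisubharmonic `u` bounded above is then constant on
each complex line through the origin (`IsSubharmonicOnPlane.eq_of_le`). For entire `f` the sub-mean
inequality comes from Jensen's formula, and the classical Liouville theorem concludes. -/

/-! ### Ball means and sets of density zero. -/

/-- A function that is at most its mean over every circle `a + e^{iθ} b` is at most its mean over
every ball. -/
theorem mul_volume_ball_le_lintegral {n : ℕ} {v : EuclideanSpace ℂ (Fin n) → ENNReal}
    (hv : Measurable v)
    (hsub : ∀ a b, b ≠ 0 → v a ≤ (ENNReal.ofReal (2 * Real.pi))⁻¹ *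
      ∫⁻ θ in Set.Ioc 0 (2 * Real.pi), v (a + circleMap 0 1 θ • b))
    (a : EuclideanSpace ℂ (Fin n)) (R : ℝ) :
    v a * volume (Metric.ball a R) ≤ ∫⁻ w in Metric.ball a R, v w := by
  set c := ENNReal.ofReal (2 * Real.pi) with hc
  have hc0 : c ≠ 0 := by simp [hc, Real.pi_pos]
  have hct : c ≠ ⊤ := ENNReal.ofReal_ne_top
  have hsub' : ∀ b, v a ≤ c⁻¹ * ∫⁻ θ in Set.Ioc 0 (2 * Real.pi), v (a + circleMap 0 1 θ • b) := by
    intro b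
    rcases eq_or_ne b 0 with rfl | hb
    · simp only [smul_zero, add_zero, setLIntegral_const, Real.volume_Ioc, sub_zero, ← hc]
      rw [mul_comm (v a), ← mul_assoc, ENNReal.inv_mul_cancel hc0 hct, one_mul]
    · exact hsub a b hb
  -- Multiplication by `e^{iθ}` is an isometry, so `b ↦ a + e^{iθ} b` carries `B(0, R)` onto `B(a,
  -- R)` and preserves volume. Averaging the circle inequality over `b` thus gives the same ball
  -- integral for every `θ`.
  have htrans : ∀ θ : ℝ, ∫⁻ b in Metric.ball 0 R, v (a + circleMap 0 1 θ • b)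
      = ∫⁻ w in Metric.ball a R, v w := by
    intro θ
    have hθ : ‖circleMap 0 1 θ‖ = 1 := by simp
    have hne : circleMap 0 1 θ ≠ 0 := by rw [← norm_ne_zero_iff, hθ]; exact one_ne_zero
    let e : EuclideanSpace ℂ (Fin n) ≃ₗᵢ[ℝ] EuclideanSpace ℂ (Fin n) :=
      { (LinearEquiv.smulOfNeZero ℂ (EuclideanSpace ℂ (Fin n)) _ hne).restrictScalars ℝ with
        norm_map' := fun x => by
          change ‖circleMap 0 1 θ • x‖ = ‖x‖
          rw [norm_smul, hθ, one_mul] }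
    have he : MeasurePreserving (fun b => a + circleMap 0 1 θ • b)
        (volume : Measure (EuclideanSpace ℂ (Fin n))) volume :=
      (measurePreserving_add_left volume a).comp e.measurePreserving
    rw [← he.setLIntegral_comp_preimage Metric.isOpen_ball.measurableSet hv]
    congr 2
    ext b
    simp [norm_smul]
  have hmeas : Measurable (fun p : EuclideanSpace ℂ (Fin n) × ℝ =>
      v (a + circleMap 0 1 p.2 • p.1)) := by
    refine hv.comp (Continuous.measurable ?_)
    fun_prop
  calc v a * volume (Metric.ball a R)
      = ∫⁻ b in Metric.ball (0 : EuclideanSpace ℂ (Fin n)) R, v a := by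
        rw [setLIntegral_const, Measure.addHaar_ball_center]
    _ ≤ ∫⁻ b in Metric.ball (0 : EuclideanSpace ℂ (Fin n)) R,
        c⁻¹ * ∫⁻ θ in Set.Ioc 0 (2 * Real.pi), v (a + circleMap 0 1 θ • b) :=
        lintegral_mono hsub'
    _ = c⁻¹ * ∫⁻ θ in Set.Ioc 0 (2 * Real.pi),
        ∫⁻ b in Metric.ball (0 : EuclideanSpace ℂ (Fin n)) R, v (a + circleMap 0 1 θ • b) := by
        rw [lintegral_const_mul' _ _ (ENNReal.inv_ne_top.2 hc0),
          lintegral_lintegral_swap hmeas.aemeasurable]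
    _ = ∫⁻ w in Metric.ball a R, v w := by
        simp only [htrans, setLIntegral_const, Real.volume_Ioc, sub_zero, ← hc]
        rw [mul_comm _ c, ← mul_assoc, ENNReal.inv_mul_cancel hc0 hct, one_mul]

theorem volume_inter_ball_eventually_le {n : ℕ} {E : Set (EuclideanSpace ℂ (Fin n))}
    (hE : HasRelativeLebesgueDensity E 0) {δ : ℝ} (hδ : 0 < δ) :
    ∀ᶠ r : ℝ in atTop, ∀ a : EuclideanSpace ℂ (Fin n),
      volume (E ∩ Metric.ball 0 (2 * r)) ≤ ENNReal.ofReal δ * volume (Metric.ball a r) := by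
  have hV : 0 < volume.real (Metric.ball (0 : EuclideanSpace ℂ (Fin n)) 1) :=
    ENNReal.toReal_pos (Metric.measure_ball_pos _ _ one_pos).ne' measure_ball_lt_top.ne
  set V := volume.real (Metric.ball (0 : EuclideanSpace ℂ (Fin n)) 1) with hVdef
  have h2 : Tendsto (fun r : ℝ => 2 * r) atTop atTop := tendsto_id.const_mul_atTop two_pos
  -- The density at radius `2r` is normalised by `(2r)^{2n}`, while `B(a, r)` has volume `V r^{2n}`.
  have hη : 0 < δ * V / 2 ^ (2 * n) := by positivity
  filter_upwards [(hE.2.comp h2).eventually (gt_mem_nhds hη), eventually_gt_atTop 0] with r hr hr0 a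
  simp only [Function.comp] at hr
  have hfr : Module.finrank ℝ (EuclideanSpace ℂ (Fin n)) = 2 * n := by
    rw [← Module.finrank_mul_finrank ℝ ℂ]; simp
  have hb := Measure.addHaar_ball_mul_of_pos (volume : Measure (EuclideanSpace ℂ (Fin n))) a hr0 1
  rw [mul_one, hfr] at hb
  rw [hb, ← ENNReal.ofReal_toReal (measure_ball_lt_top (x := (0 : EuclideanSpace ℂ (Fin n)))).ne,
    ← ENNReal.ofReal_mul (by positivity), ← ENNReal.ofReal_mul hδ.le]
  refine (ENNReal.le_ofReal_iff_toReal_le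
    ((measure_mono Set.inter_subset_right).trans_lt measure_ball_lt_top).ne (by positivity)).2 ?_
  rw [div_lt_iff₀ (by positivity)] at hr
  refine hr.le.trans_eq ?_
  rw [mul_pow, ← Measure.real, ← hVdef]
  field_simp

/-- Functions of polynomial growth with the sub-mean value property on balls that are bounded off
a set of density zero are bounded. -/
theorem bounded_of_bounded_off_density_zero {n : ℕ} {E : Set (EuclideanSpace ℂ (Fin n))}
    (hE : HasRelativeLebesgueDensity E 0) {v : EuclideanSpace ℂ (Fin n) → ENNReal}
    (hsub : ∀ a R, v a * volume (Metric.ball a R) ≤ ∫⁻ w in Metric.ball a R, v w)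
    {K C : ℝ} (hK : 0 ≤ K) (hC : 0 ≤ C) {N : ℕ}
    (hbdd : ∀ z ∉ E, v z ≤ ENNReal.ofReal K)
    (hgrowth : ∀ z, v z ≤ ENNReal.ofReal (C * (1 + ‖z‖) ^ N)) (z : EuclideanSpace ℂ (Fin n)) :
    v z ≤ ENNReal.ofReal (2 * K) := by
  have hδ : (0 : ℝ) < (1 / 2) ^ (N + 1) := by positivity
  obtain ⟨R₀, hR₀⟩ := eventually_atTop.1
    ((volume_inter_ball_eventually_le hE hδ).and (eventually_gt_atTop 0))
  have hstep : ∀ (S : ℝ) (r : ℝ), 0 ≤ S → R₀ ≤ r →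
      (∀ w, ‖w‖ ≤ 2 * r → v w ≤ ENNReal.ofReal S) →
      ∀ a, ‖a‖ ≤ r → v a ≤ ENNReal.ofReal (K + (1 / 2) ^ (N + 1) * S) := by
    intro S r hS hr hvS a ha
    obtain ⟨hvol, hr0⟩ := hR₀ r hr
    have hB0 : volume (Metric.ball a r) ≠ 0 := (Metric.measure_ball_pos _ _ hr0).ne'
    have hBt : volume (Metric.ball a r) ≠ ⊤ := measure_ball_lt_top.ne
    have hball : Metric.ball a r ⊆ Metric.ball 0 (2 * r) := by
      refine Metric.ball_subset_ball' ?_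
      rw [dist_zero_right]; linarith
    refine (ENNReal.mul_le_mul_iff_left hB0 hBt).1 ((hsub a r).trans ?_)
    calc ∫⁻ w in Metric.ball a r, v w
        ≤ ∫⁻ w in Metric.ball a r,
            (ENNReal.ofReal K + E.indicator (fun _ => ENNReal.ofReal S) w) := by
          refine setLIntegral_mono' Metric.isOpen_ball.measurableSet fun w hw => ?_
          by_cases hwE : w ∈ E
          · rw [Set.indicator_of_mem hwE]
            refine le_add_left (hvS w ?_)
            exact (mem_ball_zero_iff.1 (hball hw)).le
          · exact le_add_right (hbdd w hwE)
      _ ≤ ENNReal.ofReal K * volume (Metric.ball a r)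
            + ENNReal.ofReal S * volume (E ∩ Metric.ball 0 (2 * r)) := by
          rw [lintegral_add_left measurable_const, setLIntegral_const]
          gcongr
          refine (lintegral_indicator_const_le _ _).trans ?_
          rw [Measure.restrict_apply' Metric.isOpen_ball.measurableSet]
          gcongr
      _ ≤ ENNReal.ofReal K * volume (Metric.ball a r)
            + ENNReal.ofReal S * (ENNReal.ofReal ((1 / 2) ^ (N + 1)) * volume (Metric.ball a r)) := by
          gcongr; exact hvol a
      _ = ENNReal.ofReal (K + (1 / 2) ^ (N + 1) * S) * volume (Metric.ball a r) := by
          rw [ENNReal.ofReal_add hK (by positivity), ENNReal.ofReal_mul hδ.le]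
          ring
  -- The bound is claimed for all `r ≥ R₀` at once, since the step at `r` uses the previous bound at
  -- `2r`. The constant `2K` reproduces itself: `K + δ · 2K ≤ 2K` as `δ ≤ 1/2`.
  have hind : ∀ (k : ℕ) (r : ℝ), R₀ ≤ r → ∀ a, ‖a‖ ≤ r →
      v a ≤ ENNReal.ofReal (2 * K + (1 / 2) ^ k * (C * (1 + r) ^ N)) := by
    intro k
    induction k with
    | zero =>
      intro r hr a ha
      refine (hgrowth a).trans (ENNReal.ofReal_le_ofReal ?_)
      have : C * (1 + ‖a‖) ^ N ≤ C * (1 + r) ^ N := by gcongr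
      linarith
    | succ k ih =>
      intro r hr a ha
      have hr0 : 0 < r := (hR₀ r hr).2
      refine (hstep _ r (by positivity) hr (ih (2 * r) (by linarith)) a ha).trans
        (ENNReal.ofReal_le_ofReal ?_)
      have h1 : (1 + 2 * r) ^ N ≤ 2 ^ N * (1 + r) ^ N := by
        rw [← mul_pow]; gcongr; linarith
      have h2 : ((1 : ℝ) / 2) ^ (N + 1) ≤ 1 / 2 := by
        rw [pow_succ]
        have : ((1 : ℝ) / 2) ^ N ≤ 1 := pow_le_one₀ (by norm_num) (by norm_num)
        linarith
      have h3 : ((1 : ℝ) / 2) ^ (N + 1) * ((1 / 2) ^ k * (C * (1 + 2 * r) ^ N))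
          ≤ (1 / 2) ^ (N + 1) * ((1 / 2) ^ k * (C * (2 ^ N * (1 + r) ^ N))) := by
        gcongr
      have h4 : ((1 : ℝ) / 2) ^ (N + 1) * ((1 / 2) ^ k * (C * (2 ^ N * (1 + r) ^ N)))
          = (1 / 2) ^ (k + 1) * (C * (1 + r) ^ N) := by
        have : ((1 : ℝ) / 2) ^ N * 2 ^ N = 1 := by rw [← mul_pow]; norm_num
        calc _ = ((1 : ℝ) / 2) ^ N * 2 ^ N * ((1 / 2) ^ (k + 1) * (C * (1 + r) ^ N)) := by ring
          _ = _ := by rw [this, one_mul]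
      nlinarith
  have hlim : Tendsto (fun k : ℕ => ENNReal.ofReal
      (2 * K + (1 / 2) ^ k * (C * (1 + max R₀ ‖z‖) ^ N))) atTop (𝓝 (ENNReal.ofReal (2 * K))) := by
    refine ENNReal.tendsto_ofReal ?_
    have h := (tendsto_pow_atTop_nhds_zero_of_lt_one (r := (1 / 2 : ℝ)) (by norm_num)
      (by norm_num)).mul_const (C * (1 + max R₀ ‖z‖) ^ N)
    simpa using h.const_add (2 * K)
  exact ge_of_tendsto' hlim fun k => hind k _ (le_max_left _ _) z (le_max_right _ _)

/-! ### Liouville's theorem for real-valued subharmonic functions. -/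

/-- An upper semicontinuous function on a circle whose mean is at least an upper bound equals this
bound. -/
theorem eq_on_sphere_of_le_circleAverage {w : ℂ → ℝ} {c : ℂ} {r m : ℝ} (hr : 0 ≤ r)
    (husc : UpperSemicontinuous fun θ : ℝ => w (circleMap c r θ))
    (hint : CircleIntegrable w c r) (hle : ∀ z ∈ Metric.sphere c r, w z ≤ m)
    (hm : m ≤ Real.circleAverage w c r) : ∀ z ∈ Metric.sphere c r, w z = m := by
  have hpi := Real.two_pi_pos
  by_contra! hcon
  obtain ⟨p, hp, hne⟩ := hcon
  have hlt : w p < m := lt_of_le_of_ne (hle p hp) hne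
  have hle' : ∀ θ, w (circleMap c r θ) ≤ m := fun θ => hle _ (circleMap_mem_sphere c hr θ)
  have hU : IsOpen {θ : ℝ | w (circleMap c r θ) < m} := husc.isOpen_preimage m
  obtain ⟨θ₀, hθ₀, hpθ⟩ : ∃ θ ∈ Set.Icc 0 (2 * Real.pi), circleMap c r θ = p := by
    have : p ∈ circleMap c r '' Set.Ioc 0 (2 * Real.pi) := by
      rw [image_circleMap_Ioc, abs_of_nonneg hr]; exact hp
    obtain ⟨θ, hθ, h⟩ := this
    exact ⟨θ, Set.Ioc_subset_Icc_self hθ, h⟩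
  have hint' : IntervalIntegrable (fun θ => w (circleMap c r θ)) volume 0 (2 * Real.pi) := hint
  have hg : IntervalIntegrable (fun θ => m - w (circleMap c r θ)) volume 0 (2 * Real.pi) :=
    intervalIntegrable_const.sub hint'
  have hzero : ∫ θ in 0..2 * Real.pi, (m - w (circleMap c r θ)) = 0 := by
    refine le_antisymm ?_ (intervalIntegral.integral_nonneg hpi.le fun θ _ => sub_nonneg.2 (hle' θ))
    rw [intervalIntegral.integral_sub intervalIntegrable_const hint',
      intervalIntegral.integral_const, sub_zero, smul_eq_mul]
    rw [Real.circleAverage_def, smul_eq_mul, ← div_eq_inv_mul, le_div_iff₀ hpi] at hm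
    linarith
  rw [intervalIntegral.integral_of_le hpi.le,
    integral_eq_zero_iff_of_nonneg (fun θ => sub_nonneg.2 (hle' θ))
      ((intervalIntegrable_iff_integrableOn_Ioc_of_le hpi.le).1 hg)] at hzero
  have hnull : volume ({θ : ℝ | w (circleMap c r θ) < m} ∩ Set.Ioo 0 (2 * Real.pi)) = 0 := by
    have h := (ae_restrict_iff' measurableSet_Ioc).1 hzero
    refine measure_mono_null ?_ h
    rintro θ ⟨h1, h2⟩ h3
    have := h3 (Set.Ioo_subset_Ioc_self h2)
    simp only [Pi.zero_apply] at this
    have h1' : w (circleMap c r θ) < m := h1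
    linarith
  -- If `p` has its angle at an endpoint of `[0, 2π]`, openness still produces angles in the
  -- interior.
  have hne' : ({θ : ℝ | w (circleMap c r θ) < m} ∩ Set.Ioo 0 (2 * Real.pi)).Nonempty := by
    rw [← closure_Ioo hpi.ne] at hθ₀
    exact mem_closure_iff.1 hθ₀ _ hU (by simpa [hpθ] using hlt)
  exact ((hU.inter isOpen_Ioo).measure_pos volume hne').ne' hnull

/-- Liouville's theorem for real-valued subharmonic functions on the plane. -/
theorem eq_of_subharmonic_of_le {h : ℂ → ℝ} (husc : UpperSemicontinuous h)
    (hint : ∀ c r, 0 < r → CircleIntegrable h c r)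
    (hsub : ∀ c r, 0 < r → h c ≤ Real.circleAverage h c r) {M : ℝ} (hM : ∀ z, h z ≤ M) (x y : ℂ) :
    h x = h y := by
  obtain ⟨z₀, -, hz₀⟩ := (husc.upperSemicontinuousOn (Metric.closedBall 0 1)).exists_isMaxOn
    ⟨0, by simp⟩ (isCompact_closedBall 0 1)
  have hdisc : ∀ z : ℂ, ‖z‖ ≤ 1 → h z ≤ h z₀ := fun z hz => hz₀ (by simpa using hz)
  -- Off the disc, `h - ε log ‖z‖` tends to `-∞` and is subharmonic, so its maximum should be
  -- reached on the unit circle; then `ε → 0`.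
  have hlog : ∀ ε : ℝ, 0 < ε → ∀ z : ℂ, 1 ≤ ‖z‖ → h z ≤ h z₀ + ε * Real.log ‖z‖ := by
    intro ε hε z₁ hz₁
    by_contra! hcon
    set w : ℂ → ℝ := fun z => h z - ε * Real.log ‖z‖ with hw
    have hwusc : ∀ z : ℂ, z ≠ 0 → UpperSemicontinuousAt w z := by
      intro z hz
      have hc : ContinuousAt (fun z : ℂ => -(ε * Real.log ‖z‖)) z :=
        ((continuous_norm.continuousAt.log (norm_ne_zero_iff.2 hz)).const_mul ε).neg
      simpa [hw, sub_eq_add_neg] using! UpperSemicontinuousAt.add (husc z) hc.upperSemicontinuousAt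
    obtain ⟨R, hR, hR₁⟩ : ∃ R : ℝ, (∀ t, R ≤ t → M - ε * Real.log t < h z₀) ∧ ‖z₁‖ ≤ R := by
      obtain ⟨R, hR⟩ := eventually_atTop.1
        ((Real.tendsto_log_atTop.const_mul_atTop hε).eventually (eventually_gt_atTop (M - h z₀)))
      refine ⟨max R ‖z₁‖, fun t ht => ?_, le_max_right _ _⟩
      have := hR t ((le_max_left _ _).trans ht)
      linarith
    have hK : IsCompact (Metric.closedBall (0 : ℂ) R ∩ {z | 1 ≤ ‖z‖}) :=
      (isCompact_closedBall 0 R).inter_right (isClosed_le continuous_const continuous_norm)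
    obtain ⟨p, ⟨-, hp1⟩, hpmax⟩ := UpperSemicontinuousOn.exists_isMaxOn (f := w)
      (s := Metric.closedBall (0 : ℂ) R ∩ {z | 1 ≤ ‖z‖}) ⟨z₁, by simpa using hR₁, hz₁⟩ hK
      (fun z hz => (hwusc z (norm_pos_iff.1 (one_pos.trans_le hz.2))).upperSemicontinuousWithinAt _)
    have hp1 : 1 ≤ ‖p‖ := hp1
    have hpA : h z₀ < w p := by
      have h1 : w z₁ ≤ w p := hpmax ⟨by simpa using hR₁, hz₁⟩
      have h2 : h z₀ < w z₁ := by simp only [hw]; linarith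
      linarith
    have hglobal : ∀ z : ℂ, 1 ≤ ‖z‖ → w z ≤ w p := by
      intro z hz
      rcases le_total ‖z‖ R with hzR | hzR
      · exact hpmax ⟨by simpa using hzR, hz⟩
      · have h1 := hR _ hzR
        have h2 : w z ≤ M - ε * Real.log ‖z‖ := sub_le_sub_right (hM z) _
        linarith
    have hunit : ∀ z : ℂ, ‖z‖ = 1 → w z < w p := by
      intro z hz
      have : w z = h z := by simp [hw, hz]
      rw [this]; exact (hdisc z hz.le).trans_lt hpA
    have hp1' : 1 < ‖p‖ := lt_of_le_of_ne hp1 fun h => (hunit p h.symm).false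
    -- The circle about the maximum point `p` that touches the unit circle at `p / ‖p‖`: `w` would
    -- be constant on it, yet is smaller at the point of contact.
    set r := ‖p‖ - 1 with hr
    have hr0 : 0 < r := sub_pos.2 hp1'
    have hfar : ∀ z ∈ Metric.closedBall p r, 1 ≤ ‖z‖ := by
      intro z hz
      rw [mem_closedBall_iff_norm'] at hz
      have := norm_sub_norm_le p z
      linarith
    have hlogavg : Real.circleAverage (fun z : ℂ => Real.log ‖z‖) p r = Real.log ‖p‖ :=
      AnalyticOnNhd.circleAverage_log_norm_of_ne_zero (g := fun z : ℂ => z)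
        (fun z _ => analyticAt_id) (fun z hz => by
          rw [abs_of_pos hr0] at hz
          exact norm_pos_iff.1 (one_pos.trans_le (hfar z hz)))
    have hlogint : CircleIntegrable (fun z : ℂ => Real.log ‖z‖) p r :=
      MeromorphicOn.circleIntegrable_log_norm (f := fun z : ℂ => z) (fun z _ => by fun_prop)
    have hlogint' : CircleIntegrable (fun z : ℂ => ε * Real.log ‖z‖) p r := by
      simpa using! hlogint.const_smul (a := ε)
    have hwavg : w p ≤ Real.circleAverage w p r := by
      have h1 : Real.circleAverage w p r = Real.circleAverage h p r
          - Real.circleAverage (fun z : ℂ => ε * Real.log ‖z‖) p r :=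
        Real.circleAverage_sub (hint p r hr0) hlogint'
      have h2 : Real.circleAverage (fun z : ℂ => ε * Real.log ‖z‖) p r = ε * Real.log ‖p‖ := by
        rw [← hlogavg]
        exact Real.circleAverage_fun_smul (a := ε) (f := fun z : ℂ => Real.log ‖z‖)
      rw [h1, h2]
      exact sub_le_sub_right (hsub p r hr0) _
    have hcirc := eq_on_sphere_of_le_circleAverage (w := w) hr0.le
      (fun θ => by
        have hne : circleMap p r θ ≠ 0 := norm_pos_iff.1 (one_pos.trans_le
          (hfar _ (circleMap_mem_closedBall p hr0.le θ)))
        intro y hy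
        exact (continuous_circleMap p r).continuousAt.eventually (hwusc _ hne y hy))
      ((hint p r hr0).sub hlogint')
      (fun z hz => hglobal z (hfar z (Metric.sphere_subset_closedBall hz))) hwavg
    have hp0 : ‖p‖ ≠ 0 := by linarith
    have hq : ‖p / (‖p‖ : ℂ)‖ = 1 := by simp [hp0]
    refine (hunit _ hq).ne (hcirc _ ?_)
    rw [Metric.mem_sphere, dist_comm, dist_eq_norm]
    have h1 : p - p / (‖p‖ : ℂ) = (r / ‖p‖ : ℝ) * p := by
      have : (‖p‖ : ℂ) ≠ 0 := by exact_mod_cast hp0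
      rw [hr]; push_cast; field_simp
    rw [h1, norm_mul, Complex.norm_real, Real.norm_of_nonneg (by positivity)]
    field_simp
  have hmax : ∀ z, h z ≤ h z₀ := by
    intro z
    rcases le_total ‖z‖ 1 with hz | hz
    · exact hdisc z hz
    · have hlim : Tendsto (fun ε : ℝ => h z₀ + ε * Real.log ‖z‖) (𝓝[>] 0) (𝓝 (h z₀)) := by
        have : ContinuousAt (fun ε : ℝ => h z₀ + ε * Real.log ‖z‖) 0 := by fun_prop
        simpa using this.tendsto.mono_left nhdsWithin_le_nhds
      exact ge_of_tendsto hlim (eventually_mem_nhdsWithin.mono fun ε hε => hlog ε hε z hz)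
  -- Now `z₀` is a global maximum, and `z` lies on the circle about `z₀` of radius `‖z - z₀‖`.
  have hconst : ∀ z, h z = h z₀ := by
    intro z
    rcases eq_or_ne z z₀ with rfl | hne
    · rfl
    have hr0 : 0 < ‖z - z₀‖ := norm_pos_iff.2 (sub_ne_zero.2 hne)
    exact eq_on_sphere_of_le_circleAverage (w := h) hr0.le
      (UpperSemicontinuous.comp husc (continuous_circleMap z₀ _)) (hint z₀ _ hr0) (fun z _ => hmax z)
      (hsub z₀ _ hr0) z (by simp)
  rw [hconst x, hconst y]

/-! ### Extended-real subharmonic functions, by truncation. -/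

/-- The positive part of a subharmonic function satisfies the sub-mean value inequality. -/
theorem IsSubharmonicOnPlane.toENNReal_le {u : ℂ → EReal} (hu : IsSubharmonicOnPlane u) (c : ℂ)
    {r : ℝ} (hr : 0 < r) :
    (u c).toENNReal ≤ (ENNReal.ofReal (2 * Real.pi))⁻¹ *
      ∫⁻ θ in Set.Ioc 0 (2 * Real.pi), (u (circleMap c r θ)).toENNReal := by
  have h := EReal.toENNReal_le_toENNReal (hu.le_circleMean c r hr)
  rw [erealCircleMean, EReal.toENNReal_sub (EReal.coe_ennreal_nonneg _), EReal.toENNReal_coe] at h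
  exact h.trans tsub_le_self

/-- Truncation from below at a real `k` removes the value `-∞`, so that the real-valued Liouville
theorem applies. -/
theorem coe_toReal_max_coe {x : EReal} (hx : x < ⊤) (k : ℝ) :
    (((max x k).toReal : ℝ) : EReal) = max x k :=
  EReal.coe_toReal (max_lt hx (EReal.coe_lt_top k)).ne
    ((EReal.bot_lt_coe k).trans_le (le_max_right _ _)).ne'

theorem upperSemicontinuous_toReal_max {X : Type*} [TopologicalSpace X] {u : X → EReal}
    (husc : UpperSemicontinuous u) (hlt : ∀ z, u z < ⊤) (k : ℝ) :
    UpperSemicontinuous fun z => (max (u z) k).toReal := by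
  intro z y hy
  have hy' : max (u z) k < (y : EReal) := by
    rw [← coe_toReal_max_coe (hlt z) k]; exact_mod_cast hy
  filter_upwards [husc z y ((le_max_left _ _).trans_lt hy')] with w hw
  have : max (u w) k < (y : EReal) := max_lt hw ((le_max_right _ _).trans_lt hy')
  rw [← coe_toReal_max_coe (hlt w) k] at this
  exact_mod_cast this

theorem UpperSemicontinuous.circleIntegrable {h : ℂ → ℝ} (husc : UpperSemicontinuous h) {k : ℝ}
    (hk : ∀ z, k ≤ h z) (c : ℂ) (r : ℝ) : CircleIntegrable h c r := by
  have hcomp : UpperSemicontinuous fun θ => h (circleMap c r θ) :=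
    UpperSemicontinuous.comp husc (continuous_circleMap c r)
  obtain ⟨θ₀, -, hθ₀⟩ := (hcomp.upperSemicontinuousOn (Set.Icc 0 (2 * Real.pi))).exists_isMaxOn
    ⟨0, by simp [Real.pi_pos.le]⟩ isCompact_Icc
  refine (intervalIntegrable_iff_integrableOn_Ioc_of_le Real.two_pi_pos.le).2 ?_
  refine Measure.integrableOn_of_bounded (M := max |k| |h (circleMap c r θ₀)|)
    measure_Ioc_lt_top.ne hcomp.measurable.aestronglyMeasurable ?_
  filter_upwards [ae_restrict_mem measurableSet_Ioc] with θ hθ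
  exact abs_le_max_abs_abs (hk _) (hθ₀ (Set.Ioc_subset_Icc_self hθ))

/-- Truncation raises the positive part and lowers the negative part, so the mean of `max u k`
dominates that of `u`; it also dominates `k`. -/
theorem IsSubharmonicOnPlane.toReal_max_le_circleAverage {u : ℂ → EReal}
    (hu : IsSubharmonicOnPlane u) (k : ℝ) (c : ℂ) {r : ℝ} (hr : 0 < r) :
    (max (u c) k).toReal ≤ Real.circleAverage (fun z => (max (u z) k).toReal) c r := by
  have hk : ∀ z, k ≤ (max (u z) k).toReal := fun z => by
    rw [← EReal.coe_le_coe_iff, coe_toReal_max_coe (hu.lt_top z)]; exact le_max_right _ _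
  have hint : CircleIntegrable (fun z => (max (u z) k).toReal) c r :=
    (upperSemicontinuous_toReal_max hu.upperSemicontinuous hu.lt_top k).circleIntegrable hk c r
  have hint' := (intervalIntegrable_iff_integrableOn_Ioc_of_le Real.two_pi_pos.le).1 hint
  rw [← EReal.coe_le_coe_iff, coe_toReal_max_coe (hu.lt_top c)]
  refine max_le ?_ ?_
  · set P := ∫⁻ θ in Set.Ioc 0 (2 * Real.pi),
      ENNReal.ofReal (max (u (circleMap c r θ)) k).toReal with hP
    set Q := ∫⁻ θ in Set.Ioc 0 (2 * Real.pi),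
      ENNReal.ofReal (-(max (u (circleMap c r θ)) k).toReal) with hQ
    have hPt : P ≠ ⊤ := hint'.lintegral_lt_top.ne
    have hQt : Q ≠ ⊤ := hint'.neg.lintegral_lt_top.ne
    have hinv : (ENNReal.ofReal (2 * Real.pi))⁻¹ ≠ ⊤ := by simp [Real.pi_pos]
    have havg : Real.circleAverage (fun z => (max (u z) k).toReal) c r
        = ((ENNReal.ofReal (2 * Real.pi))⁻¹ * P).toReal
          - ((ENNReal.ofReal (2 * Real.pi))⁻¹ * Q).toReal := by
      rw [Real.circleAverage_def, intervalIntegral.integral_of_le Real.two_pi_pos.le,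
        integral_eq_lintegral_pos_part_sub_lintegral_neg_part hint', ENNReal.toReal_mul,
        ENNReal.toReal_mul, ENNReal.toReal_inv, ENNReal.toReal_ofReal Real.two_pi_pos.le,
        smul_eq_mul, mul_sub]
    rw [havg, EReal.coe_sub, EReal.coe_ennreal_toReal (ENNReal.mul_ne_top hinv hPt),
      EReal.coe_ennreal_toReal (ENNReal.mul_ne_top hinv hQt)]
    refine (hu.le_circleMean c r hr).trans (EReal.sub_le_sub ?_ ?_)
    · rw [EReal.coe_ennreal_le_coe_ennreal_iff]
      refine mul_le_mul_right (lintegral_mono fun θ => ?_) _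
      rw [← EReal.real_coe_toENNReal, coe_toReal_max_coe (hu.lt_top _)]
      exact EReal.toENNReal_le_toENNReal (le_max_left _ _)
    · rw [EReal.coe_ennreal_le_coe_ennreal_iff]
      refine mul_le_mul_right (lintegral_mono fun θ => ?_) _
      rw [← EReal.real_coe_toENNReal, EReal.coe_neg, coe_toReal_max_coe (hu.lt_top _)]
      exact EReal.toENNReal_le_toENNReal (EReal.neg_le_neg_iff.2 (le_max_left _ _))
  · rw [EReal.coe_le_coe_iff]
    exact (Real.circleAverage_const k c r).symm.trans_le
      (Real.circleAverage_mono (circleIntegrable_const _ _ _) hint fun z _ => hk z)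

/-- Liouville's theorem for subharmonic functions on the plane. -/
theorem IsSubharmonicOnPlane.eq_of_le {u : ℂ → EReal} (hu : IsSubharmonicOnPlane u) {M : ℝ}
    (hM : ∀ z, u z ≤ M) (x y : ℂ) : u x = u y := by
  have key : ∀ k : ℝ, max (u x) k = max (u y) k := by
    intro k
    have husc := upperSemicontinuous_toReal_max hu.upperSemicontinuous hu.lt_top k
    have hk : ∀ z, k ≤ (max (u z) k).toReal := fun z => by
      rw [← EReal.coe_le_coe_iff, coe_toReal_max_coe (hu.lt_top z)]; exact le_max_right _ _
    rw [← coe_toReal_max_coe (hu.lt_top x), ← coe_toReal_max_coe (hu.lt_top y),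
      eq_of_subharmonic_of_le husc (fun c r _ => husc.circleIntegrable hk c r)
        (fun c r hr => hu.toReal_max_le_circleAverage k c hr) (M := max M k) (fun z => ?_) x y]
    rw [← EReal.coe_le_coe_iff, coe_toReal_max_coe (hu.lt_top z),
      EReal.coe_strictMono.monotone.map_max]
    exact max_le_max_right _ (hM z)
  -- The truncations at all real levels determine an extended real below `⊤`, and `⊥` in particular.
  have hle : ∀ a b : EReal, (∀ k : ℝ, max a k = max b k) → a ≤ b := by
    intro a b h
    refine EReal.le_of_forall_lt_iff_le.1 fun k hk => ?_
    have := h k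
    rw [max_eq_right hk.le] at this
    exact (le_max_left _ _).trans this.le
  exact le_antisymm (hle _ _ key) (hle _ _ fun k => (key k).symm)

/-! ### Finite order as polynomial growth. -/

theorem IsPlurisubharmonic.lt_top {n : ℕ} (hn : 1 ≤ n) {u : EuclideanSpace ℂ (Fin n) → EReal}
    (hu : IsPlurisubharmonic u) (z : EuclideanSpace ℂ (Fin n)) : u z < ⊤ := by
  have : Nonempty (Fin n) := ⟨⟨0, hn⟩⟩
  obtain ⟨b, hb⟩ := exists_ne (0 : EuclideanSpace ℂ (Fin n))
  simpa using (hu.subharmonic_line z b hb).lt_top 0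

theorem exists_polynomial_bound_of_growthOrder_lt_top {n : ℕ}
    {u : EuclideanSpace ℂ (Fin n) → EReal} (husc : UpperSemicontinuous u) (hlt : ∀ z, u z < ⊤)
    (hord : growthOrder u < ⊤) :
    ∃ (C : ℝ) (N : ℕ), 0 ≤ C ∧ ∀ z, (u z).toENNReal ≤ ENNReal.ofReal (C * (1 + ‖z‖) ^ N) := by
  obtain ⟨ρ, hρ, -⟩ := EReal.lt_iff_exists_real_btwn.1 hord
  have hev := eventually_lt_of_limsup_lt hρ
  obtain ⟨R, -, hR⟩ := Filter.hasBasis_cobounded_norm.eventually_iff.1 hev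
  obtain ⟨a, -, ha⟩ := (husc.upperSemicontinuousOn
    (Metric.closedBall 0 (max R 2))).exists_isMaxOn
    ⟨0, by simp⟩ (isCompact_closedBall 0 (max R 2))
  -- Compactness gives the constant on a ball of radius at least `2`; beyond it `log ‖z‖ > 0`, so
  -- the order quotient can be cleared. The natural ceiling also serves a negative `ρ`.
  refine ⟨(u a).toENNReal.toReal + 1, ⌈ρ⌉₊, by positivity, fun z => ?_⟩
  have hone : (1 : ℝ) ≤ (1 + ‖z‖) ^ ⌈ρ⌉₊ := one_le_pow₀ (by linarith [norm_nonneg z])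
  rcases le_total ‖z‖ (max R 2) with hz | hz
  · have h1 : u z ≤ u a := ha (by simpa using hz)
    have h2 : (u a).toENNReal ≠ ⊤ := EReal.toENNReal_ne_top_iff.2 (hlt a).ne
    refine (EReal.toENNReal_le_toENNReal h1).trans ?_
    rw [← ENNReal.ofReal_toReal h2]
    refine ENNReal.ofReal_le_ofReal ?_
    rw [ENNReal.toReal_ofReal ENNReal.toReal_nonneg]
    nlinarith [ENNReal.toReal_nonneg (a := (u a).toENNReal)]
  · have hz2 : 2 ≤ ‖z‖ := (le_max_right _ _).trans hz
    have hlog : 0 < Real.log ‖z‖ := Real.log_pos (by linarith)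
    have h := hR ((le_max_left _ _).trans hz)
    rw [EReal.div_lt_iff (by exact_mod_cast hlog) (EReal.coe_ne_top _), ← EReal.coe_mul] at h
    have h1 : ENNReal.log (1 + (u z).toENNReal) ≤ ENNReal.log (ENNReal.ofReal (‖z‖ ^ ⌈ρ⌉₊)) := by
      rw [ENNReal.log_ofReal_of_pos (by positivity), Real.log_pow]
      refine h.le.trans (EReal.coe_le_coe_iff.2 ?_)
      exact mul_le_mul_of_nonneg_right (Nat.le_ceil ρ) hlog.le
    refine (le_add_self.trans (ENNReal.log_strictMono.le_iff_le.1 h1)).trans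
      (ENNReal.ofReal_le_ofReal ?_)
    calc ‖z‖ ^ ⌈ρ⌉₊ ≤ 1 * (1 + ‖z‖) ^ ⌈ρ⌉₊ := by rw [one_mul]; gcongr; linarith
      _ ≤ _ := by gcongr; linarith [ENNReal.toReal_nonneg (a := (u a).toENNReal)]

/-! ### The positive part of `ln |f|`. -/

/-- At zeros of `f` the convention `Real.log 0 = 0` agrees with the positive part of `-∞`. -/
theorem toENNReal_logAbs {n : ℕ} (f : EuclideanSpace ℂ (Fin n) → ℂ)
    (z : EuclideanSpace ℂ (Fin n)) :
    (logAbs f z).toENNReal = ENNReal.ofReal (Real.log ‖f z‖) := by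
  rcases eq_or_ne (f z) 0 with h | h
  · simp [logAbs, h]
  · rw [logAbs, ← ofReal_norm, ENNReal.log_ofReal_of_pos (norm_pos_iff.2 h),
      EReal.real_coe_toENNReal]

/-- Jensen's formula: the excess of the mean is the sum over zeros `w` in the disc of multiplicity
times `log (1 / ‖w‖) ≥ 0`. -/
theorem log_norm_le_circleAverage {g : ℂ → ℂ} (hg : Differentiable ℂ g) (hg0 : g 0 ≠ 0) :
    Real.log ‖g 0‖ ≤ Real.circleAverage (fun z => Real.log ‖g z‖) 0 1 := by
  have han : AnalyticOnNhd ℂ g (Metric.closedBall 0 |1|) := fun z _ => hg.analyticAt z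
  rw [han.circleAverage_log_norm one_ne_zero hg0]
  refine le_add_of_nonneg_left (finsum_nonneg fun w => ?_)
  by_cases hw : w ∈ Metric.closedBall (0 : ℂ) |1|
  · have h1 : 0 ≤ MeromorphicOn.divisor g (Metric.closedBall 0 |1|) w :=
      MeromorphicOn.AnalyticOnNhd.divisor_nonneg han w
    refine mul_nonneg (by exact_mod_cast h1) ?_
    rcases eq_or_ne w 0 with rfl | hw0
    · simp
    · refine Real.log_nonneg ?_
      rw [one_mul, zero_sub, norm_neg]
      exact (one_le_inv₀ (norm_pos_iff.2 hw0)).2 (by simpa using hw)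
  · simp [Function.locallyFinsuppWithin.apply_eq_zero_of_notMem _ hw]

theorem ofReal_log_norm_le {g : ℂ → ℂ} (hg : Differentiable ℂ g) :
    ENNReal.ofReal (Real.log ‖g 0‖) ≤ (ENNReal.ofReal (2 * Real.pi))⁻¹ *
      ∫⁻ θ in Set.Ioc 0 (2 * Real.pi), ENNReal.ofReal (Real.log ‖g (circleMap 0 1 θ)‖) := by
  rcases eq_or_ne (g 0) 0 with h0 | h0
  · simp [h0]
  have hint : CircleIntegrable (fun z => Real.log ‖g z‖) 0 1 :=
    MeromorphicOn.circleIntegrable_log_norm fun z _ => (hg.analyticAt z).meromorphicAt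
  refine (ENNReal.ofReal_le_ofReal (log_norm_le_circleAverage hg h0)).trans ?_
  rw [Real.circleAverage_def, smul_eq_mul, ENNReal.ofReal_mul (by positivity),
    ENNReal.ofReal_inv_of_pos Real.two_pi_pos, intervalIntegral.integral_of_le Real.two_pi_pos.le,
    integral_eq_lintegral_pos_part_sub_lintegral_neg_part
      ((intervalIntegrable_iff_integrableOn_Ioc_of_le Real.two_pi_pos.le).1 hint)]
  gcongr
  exact (ENNReal.ofReal_le_ofReal (sub_le_self _ ENNReal.toReal_nonneg)).trans
    ENNReal.ofReal_toReal_le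

/-! ### The two Liouville theorems. -/

theorem mainTheorem2 (n : ℕ) (hn : 1 ≤ n) (E : Set (EuclideanSpace ℂ (Fin n)))
    (hE : HasRelativeLebesgueDensity E 0) :
    (∀ u : EuclideanSpace ℂ (Fin n) → EReal, IsPlurisubharmonic u → growthOrder u < ⊤ →
      (∃ M : ℝ, ∀ z ∉ E, u z ≤ (M : EReal)) → ∃ c : EReal, ∀ z, u z = c) ∧
    (∀ f : EuclideanSpace ℂ (Fin n) → ℂ, Differentiable ℂ f → growthOrder (logAbs f) < ⊤ →
      (∃ M : ℝ, ∀ z ∉ E, ‖f z‖ ≤ M) → ∃ c : ℂ, ∀ z, f z = c) := by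
  constructor
  · rintro u hu hord ⟨M, hM⟩
    obtain ⟨C, N, hC, hgrowth⟩ := exists_polynomial_bound_of_growthOrder_lt_top
      hu.upperSemicontinuous (hu.lt_top hn) hord
    have hball := mul_volume_ball_le_lintegral (v := fun z => (u z).toENNReal)
      hu.upperSemicontinuous.measurable.ereal_toENNReal fun a b hb => by
        simpa using (hu.subharmonic_line a b hb).toENNReal_le 0 one_pos
    have hbound := bounded_of_bounded_off_density_zero hE hball (le_max_right M 0) hC
      (fun z hz => (EReal.toENNReal_le_toENNReal (hM z hz)).trans
        (ENNReal.ofReal_le_ofReal (le_max_left M 0))) hgrowth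
    have hle : ∀ z, u z ≤ ((2 * max M 0 : ℝ) : EReal) := by
      intro z
      have h1 : u z ≤ ((u z).toENNReal : EReal) := by
        rw [EReal.coe_toENNReal_eq_max]; exact le_max_right _ _
      have h2 : 0 ≤ 2 * max M 0 := by positivity
      refine h1.trans ((EReal.coe_ennreal_le_coe_ennreal_iff.2 (hbound z)).trans_eq ?_)
      rw [EReal.coe_ennreal_ofReal, max_eq_left h2]
    refine ⟨u 0, fun z => ?_⟩
    rcases eq_or_ne z 0 with rfl | hz
    · rfl
    -- The line `ζ ↦ ζ • z` joins `0` to `z`.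
    simpa using (hu.subharmonic_line 0 z hz).eq_of_le (fun ζ => hle _) 1 0
  · rintro f hf hord ⟨M, hM⟩
    have hcont : Continuous (logAbs f) := ENNReal.continuous_log.comp hf.continuous.enorm
    have hlt : ∀ z, logAbs f z < ⊤ := fun z => by simp [logAbs, lt_top_iff_ne_top]
    obtain ⟨C, N, hC, hgrowth⟩ := exists_polynomial_bound_of_growthOrder_lt_top
      hcont.upperSemicontinuous hlt hord
    simp only [toENNReal_logAbs] at hgrowth
    have hball := mul_volume_ball_le_lintegral
      (v := fun z => ENNReal.ofReal (Real.log ‖f z‖))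
      (Real.measurable_log.comp hf.continuous.norm.measurable).ennreal_ofReal fun a b hb => by
        simpa using ofReal_log_norm_le (g := fun ζ : ℂ => f (a + ζ • b))
          (hf.comp (by fun_prop))
    have hbound := bounded_of_bounded_off_density_zero hE hball (le_max_right (Real.log M) 0) hC
      (fun z hz => ENNReal.ofReal_le_ofReal (by
        rcases eq_or_ne (f z) 0 with h0 | h0
        · simp [h0]
        · exact le_max_of_le_left (Real.log_le_log (norm_pos_iff.2 h0) (hM z hz)))) hgrowth
    refine ⟨f 0, fun z => hf.apply_eq_apply_of_bounded ?_ z 0⟩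
    refine isBounded_iff_forall_norm_le.2 ⟨Real.exp (2 * max (Real.log M) 0), ?_⟩
    rintro _ ⟨w, rfl⟩
    rcases eq_or_ne (f w) 0 with h0 | h0
    · rw [h0, norm_zero]; positivity
    · rw [← Real.log_le_iff_le_exp (norm_pos_iff.2 h0)]
      exact (ENNReal.ofReal_le_ofReal_iff (by positivity)).1 (hbound w)
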